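/- Let $\lambda,\partial,\theta$ be infinite cardinals such that $\partial$ and $\theta$ are regular, $\partial>\theta^+$ and $\lambda=\partial^+$ (so $\partial > \theta^+ > \theta \ge \aleph_0$ are all regular). Then $\mathrm{Pr}_1(\lambda,\lambda,\lambda,\theta)$ holds. Here cardinals are identified with initial ordinals, $[\lambda]^2$ is the set of two-element subsets of $\lambda$, and $\mathrm{Pr}_1(\lambda,\lambda,\lambda,\theta)$ is the following assertion. There is a colouring $c:[\lambda]^2\to\lambda$ such that for all ordinals $i_0,i_1<\theta$, all sequences $\langle\zeta^0_{\alpha,j}:\alpha<\lambda,\,j<i_0\rangle$ and $\langle\zeta^1_{\alpha,j}:\alpha<\lambda,\,j<i_1\rangle$ of ordinals below $\lambda$, each without repetitions and with disjoint ranges, and every colour $\gamma<\lambda$, there are $\alpha_0<\alpha_1<\lambda$ such that $$c\{\zeta^0_{\alpha_0,j_0},\zeta^1_{\alpha_1,j_1}\}=\gamma\quad\text{for all } j_0<i_0 \text{ and } j_1<i_1 .$$ -/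

import Mathlib

universe u

/-- The cardinal `κ`, regarded as a set of ordinals: the set of all ordinals below (the initial
ordinal of) `κ`. -/
abbrev OrdBelow (κ : Cardinal.{u}) : Type (u + 1) := Set.Iio κ.ord

/-- `[X]²`, the set of all unordered pairs of distinct elements of `X`. -/
abbrev UnorderedPairs (X : Type*) : Type _ := {s : Finset X // s.card = 2}

/-- The unordered pair `{x, y}`, for distinct `x` and `y`. -/
def mkPair {X : Type*} [DecidableEq X] (x y : X) (h : x ≠ y) : UnorderedPairs X :=
  ⟨{x, y}, Finset.card_pair h⟩

open Classical in
/-- The colouring `c : [lam]² → sigma` witnesses `Pr₁(lam, mu, sigma, (theta₀, theta₁))`: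
whenever `i₀ < theta₀` and `i₁ < theta₁` are ordinals, `⟨ζ₀ α i : α < mu, i < i₀⟩` and
`⟨ζ₁ α i : α < mu, i < i₁⟩` are sequences of ordinals below `lam` without repetitions and with
disjoint ranges, and `γ < sigma` is a colour, there are `α₀ < α₁ < mu` such that
`c {ζ₀ α₀ j₀, ζ₁ α₁ j₁} = γ` for all `j₀ < i₀` and `j₁ < i₁`. -/
def WitnessesPr₁ (lam mu sigma theta₀ theta₁ : Cardinal.{u})
    (c : UnorderedPairs (OrdBelow lam) → OrdBelow sigma) : Prop :=
  ∀ (i₀ i₁ : Ordinal.{u}), i₀ < theta₀.ord → i₁ < theta₁.ord →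
  ∀ (ζ₀ : OrdBelow mu → Set.Iio i₀ → OrdBelow lam)
    (ζ₁ : OrdBelow mu → Set.Iio i₁ → OrdBelow lam),
    Function.Injective (Function.uncurry ζ₀) →
    Function.Injective (Function.uncurry ζ₁) →
    ∀ (hdisj : ∀ α j β k, ζ₀ α j ≠ ζ₁ β k) (γ : OrdBelow sigma),
      ∃ α₀ α₁ : OrdBelow mu, α₀ < α₁ ∧
        ∀ (j₀ : Set.Iio i₀) (j₁ : Set.Iio i₁),
          c (mkPair (ζ₀ α₀ j₀) (ζ₁ α₁ j₁) (hdisj α₀ j₀ α₁ j₁)) = γ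

/-- `Pr₁(lam, mu, sigma, (theta₀, theta₁))`, a notion used for
`lam ≥ mu ≥ sigma + theta₀ + theta₁`. -/
def Pr₁Pair (lam mu sigma theta₀ theta₁ : Cardinal.{u}) : Prop :=
  ∃ c : UnorderedPairs (OrdBelow lam) → OrdBelow sigma,
    WitnessesPr₁ lam mu sigma theta₀ theta₁ c

/-- `Pr₁(lam, mu, sigma, theta)`, that is, `Pr₁(lam, mu, sigma, (theta, theta))`. -/
def Pr₁ (lam mu sigma theta : Cardinal.{u}) : Prop :=
  Pr₁Pair lam mu sigma theta theta

/-!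
Let `L` be the cardinal `lam = del⁺`, and `D = del`. Choose for each `a : L` a ladder `e a`, cofinal
below `a`, whose proper initial segments have fewer than `D` elements. If `δ` has cofinality `D`,
then no ladder of a point above `δ` accumulates to `δ`. Hence a walk from `ζ > δ` to a point `ξ`
just below `δ` is the walk from `ζ` to `δ` followed by the walk from `δ` to `ξ`
(`IsLadder.exists_walk_eq_append`), and this holds simultaneously for fewer than `D` many `ζ`.

Label the points of `L` by elements of an uncountable regular cardinal `T < D`, so that arbitrarily
large labels occur stationarily often. Given two families `x`, `y` of sequences shorter than `T`
and a stationary set `R` of points of cofinality `D`, there are `x α₀` and `y α₁` such that all walks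
from `y α₁` to `x α₀` have a common middle part `χ` which meets `R` and in which a label occurs that
exceeds all labels outside of `χ` (`exists_rectangle`). This is arranged by routing the walks
through points `δ₁ > δ₂ > δ₃ > δ₄` of cofinality `D`: the labels met before `δ₁` and after `δ₄` are
bounded by an `ε < T` fixed in advance, because `T` is regular and `T < D`; then `δ₂` is chosen with
a label above `ε`, and `δ₃` in `R`.

The place where a walk first attains its greatest label is therefore in `χ`, at the same point for
the whole rectangle, and a point of `R` is found at a fixed integer offset from that place
(`exists_offsetEntry_eq`). The offset depends on the families, but there are only countably many
offsets, and countably many families can be concatenated as `T` is uncountable. So some offset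
locates points of `R` for all families (`exists_hitsRectangles`). By Ulam's theorem there are `lam`
disjoint stationary sets of points of cofinality `D` (`exists_stationaryAt_fibers`); one offset
serves `lam` of them, and colouring a pair by the set in which the located point lies gives the
colouring (`exists_colouring`).

The assumption `theta⁺ < del` permits taking `T = theta⁺`, which is uncountable even if `theta` is
`ℵ₀`.
-/

universe v

open Cardinal Set Order

section Stationary

variable {L : Type v} [LinearOrder L]

/-! ### Bounding small families -/

/-- A family with fewer members than the cofinality of a linear order is strictly bounded. -/
theorem exists_forall_lt_of_mk_lt_cof {X I : Type v} [LinearOrder X] (h : #I < cof X)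
    (f : I → X) : ∃ b, ∀ i, f i < b := by
  have : ¬ IsCofinal (range f) := fun hc => (cof_le hc).not_gt (mk_range_le.trans_lt h)
  obtain ⟨b, hb⟩ := not_isCofinal_iff.1 this
  exact ⟨b, fun i => hb _ ⟨i, rfl⟩⟩

/-- A family of fewer than `cof δ` points below `δ` is bounded strictly below `δ`. -/
theorem exists_lt_forall_lt_of_mk_lt_cof_Iio {δ : L} {I : Type v} (h : #I < cof (Iio δ))
    (f : I → L) (hf : ∀ i, f i < δ) : ∃ b < δ, ∀ i, f i < b := by
  obtain ⟨b, hb⟩ := exists_forall_lt_of_mk_lt_cof h fun i => (⟨f i, hf i⟩ : Iio δ)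
  exact ⟨b, b.2, fun i => hb i⟩

theorem mk_Iio_toType_ord {D : Cardinal.{v}} (i : D.ord.ToType) : #(Iio i) < D := by
  simpa using mk_Iio_lt i (by simp)

theorem noMaxOrder_of_lt_cof {D : Cardinal.{v}} (hD : D.IsRegular) (hL : D < cof L) :
    NoMaxOrder L :=
  ⟨fun a =>
    let ⟨b, hb⟩ := exists_forall_lt_of_mk_lt_cof (I := PUnit)
      (by simpa using (hD.nat_lt 1).trans hL) fun _ => a
    ⟨b, hb ⟨⟩⟩⟩

/-- Pigeonhole along a point `δ` of large cofinality: if to every `ξ < δ` a colour from a small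
linear order is attached, then a single colour bounds the colours of cofinally many `ξ`. -/
theorem exists_bound_cofinally {N : Type v} [LinearOrder N] {δ : L} (h : #N < cof (Iio δ))
    (b : L → N) : ∃ n, ∀ η < δ, ∃ ξ, η ≤ ξ ∧ ξ < δ ∧ b ξ ≤ n := by
  by_contra! H
  choose g hg hb using H
  obtain ⟨ξ, hξ, hgξ⟩ := exists_lt_forall_lt_of_mk_lt_cof_Iio h g hg
  exact lt_irrefl _ (hb (b ξ) ξ (hgξ _).le hξ)

theorem exists_injOn_Iio {D : Cardinal.{v}} (hD : D ≠ 0) (hIio : ∀ a : L, #(Iio a) ≤ D) :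
    ∃ g : L → L → D.ord.ToType, ∀ a, InjOn (g a) (Iio a) := by
  have : Nonempty D.ord.ToType := by rwa [← mk_ne_zero_iff, mk_ord_toType]
  have f : ∀ a : L, Iio a ↪ D.ord.ToType := fun a =>
    Classical.choice ((Cardinal.le_def _ _).1 ((hIio a).trans_eq (mk_ord_toType D).symm))
  classical
  refine ⟨fun a b => if h : b < a then f a ⟨b, h⟩ else Classical.arbitrary _, ?_⟩
  intro a b hb c hc h
  simp only [mem_Iio] at hb hc
  simp only [hb, hc, dif_pos] at h
  exact congrArg Subtype.val ((f a).injective h)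

/-! ### Stationary sets of points of cofinality at least `D` -/

/-- `A` is stationary at cofinality `D`: for every `g : L → L` there are arbitrarily large
`δ ∈ A` of cofinality at least `D` that are closed under `g`. When `L` is a regular uncountable
cardinal, the points closed under some `g` generate the club filter, so this says that
`{δ ∈ A | D ≤ cof δ}` is stationary in the usual sense. -/
def StationaryAt (D : Cardinal.{v}) (A : Set L) : Prop :=
  ∀ (a : L) (g : L → L), ∃ δ ∈ A, D ≤ cof (Iio δ) ∧ a < δ ∧ ∀ η < δ, g η < δ

variable {D : Cardinal.{v}}

theorem StationaryAt.mono {A B : Set L} (hA : StationaryAt D A) (h : A ⊆ B) :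
    StationaryAt D B := fun a g =>
  let ⟨δ, hδ, h'⟩ := hA a g
  ⟨δ, h hδ, h'⟩

theorem StationaryAt.exists_of_iUnion {I : Type v} (hI : #I < cof L) {A : I → Set L}
    (h : StationaryAt D (⋃ i, A i)) : ∃ i, StationaryAt D (A i) := by
  by_contra! H
  simp only [StationaryAt] at H
  push Not at H
  choose a g hg using H
  obtain ⟨a', ha'⟩ := exists_forall_lt_of_mk_lt_cof hI a
  choose g' hg' using fun η => exists_forall_lt_of_mk_lt_cof hI fun i => g i η
  obtain ⟨δ, hδ, hc, haδ, hgδ⟩ := h a' g'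
  obtain ⟨i, hi⟩ := mem_iUnion.1 hδ
  obtain ⟨η, hη, h1⟩ := hg i δ hi hc ((ha' i).trans haδ)
  exact h1.not_gt ((hg' η i).trans (hgδ η hη))

/-- Stationarity is preserved by intersecting with the points closed under a function. -/
theorem StationaryAt.inter_closed {A : Set L} (h : StationaryAt D A) (f : L → L) (b : L) :
    StationaryAt D {δ ∈ A | D ≤ cof (Iio δ) ∧ b < δ ∧ ∀ η < δ, f η < δ} := by
  intro a g
  obtain ⟨δ, hδ, hc, ha, hg⟩ := h (max a b) fun η => max (f η) (g η)
  obtain ⟨ha, hb⟩ := max_lt_iff.1 ha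
  exact ⟨δ, ⟨hδ, hc, hb, fun η hη => (max_lt_iff.1 (hg η hη)).1⟩, hc, ha,
    fun η hη => (max_lt_iff.1 (hg η hη)).2⟩

theorem StationaryAt.exists_gt {A : Set L} (h : StationaryAt D A) (a : L) : ∃ δ ∈ A, a < δ :=
  let ⟨δ, hδ, _, ha, _⟩ := h a id
  ⟨δ, hδ, ha⟩

/-- A weak form of Fodor's lemma: a regressive function on a stationary set is bounded on an
unbounded subset. -/
theorem StationaryAt.exists_bound_of_regressive [Nonempty L] {A : Set L}
    (h : StationaryAt D A) (f : L → L) (hf : ∀ δ ∈ A, f δ < δ) :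
    ∃ η, ∀ a, ∃ δ ∈ A, a < δ ∧ f δ ≤ η := by
  by_contra! H
  choose g hg using H
  -- A point of `A` closed under `g` would have a value of `f` that is not below it.
  obtain ⟨δ, hδ, -, -, hgδ⟩ := h (Classical.arbitrary L) g
  exact lt_irrefl _ (hg _ δ hδ (hgδ _ (hf δ hδ)))

variable [WellFoundedLT L]

/-- The points of cofinality at least `D` are stationary: iterate a given function along a
well-order of type `D` and take the supremum. -/
theorem stationaryAt_univ (hD : D.IsRegular) (hL : D < cof L) (hIio : ∀ a : L, #(Iio a) ≤ D) :
    StationaryAt D (univ : Set L) := by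
  intro a g
  have : NoMaxOrder L := noMaxOrder_of_lt_cof hD hL
  have : NoMaxOrder D.ord.ToType := Cardinal.noMaxOrder hD.aleph0_le
  have hcofD : cof D.ord.ToType = D := by rw [Ordinal.cof_toType, hD.cof_ord]
  have hG : ∀ x : L, ∃ y, (∀ η ≤ x, g η < y) ∧ a < y ∧ x < y := by
    intro x
    obtain ⟨y, hy⟩ := exists_forall_lt_of_mk_lt_cof ((hIio x).trans_lt hL) fun η => g η
    obtain ⟨z, hz⟩ := exists_gt (max (max a x) (max y (g x)))
    simp only [max_lt_iff] at hz
    refine ⟨z, fun η hη => ?_, hz.1.1, hz.1.2⟩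
    rcases hη.lt_or_eq with hη | rfl
    · exact (hy ⟨η, hη⟩).trans hz.2.1
    · exact hz.2.2
  choose G hGg hGa hGx using hG
  have hstep : ∀ (i : D.ord.ToType) (f : ∀ j, j < i → L), ∃ b, ∀ j hj, G (f j hj) < b := by
    intro i f
    obtain ⟨b, hb⟩ := exists_forall_lt_of_mk_lt_cof ((mk_Iio_toType_ord i).trans hL)
      fun j : Iio i => G (f j j.2)
    exact ⟨b, fun j hj => hb ⟨j, hj⟩⟩
  choose F hF using hstep
  let s : D.ord.ToType → L := IsWellFounded.fix (· < ·) F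
  have hs : ∀ i j, j < i → G (s j) < s i := by
    intro i j hj
    have : s i = F i fun j _ => s j := IsWellFounded.fix_eq (· < ·) F i
    rw [this]
    exact hF i (fun j _ => s j) j hj
  have hbd : {b | ∀ i, s i < b}.Nonempty :=
    exists_forall_lt_of_mk_lt_cof ((mk_ord_toType D).trans_lt hL) s
  obtain ⟨δ, hδ, hmin⟩ := WellFounded.has_min (wellFounded_lt (α := L)) _ hbd
  have hcof : ∀ η < δ, ∃ i, η ≤ s i := by
    intro η hη
    by_contra! H
    exact hmin η H hη
  have hne : Nonempty D.ord.ToType := by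
    rw [← mk_ne_zero_iff, mk_ord_toType]
    exact hD.ne_zero
  have hup : ∀ i, G (s i) < δ := fun i =>
    let ⟨j, hj⟩ := exists_gt i
    (hs j i hj).trans (hδ j)
  refine ⟨δ, mem_univ _, le_cof_iff.2 fun S hS => ?_, ?_, fun η hη => ?_⟩
  · by_contra! hlt
    choose i hi using fun x : S => hcof x.1 x.1.2
    obtain ⟨j, hj⟩ := exists_forall_lt_of_mk_lt_cof (hlt.trans_eq hcofD.symm) i
    obtain ⟨x, hx, hjx⟩ := hS ⟨s j, hδ j⟩
    have h1 : s j ≤ s (i ⟨x, hx⟩) := le_trans hjx (hi ⟨x, hx⟩)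
    exact (h1.trans_lt ((hGx _).trans (hs j _ (hj ⟨x, hx⟩)))).false
  · exact (hGa _).trans (hup (Classical.arbitrary _))
  · obtain ⟨i, hi⟩ := hcof η hη
    exact (hGg _ _ hi).trans (hup i)

/-- Ulam's matrix argument: fix for each `β` an injection `g β` of the points below `β` into `D`.
For some `i`, the map sending `β` to the point `α < β` with `g β α = i` has more than `D`
stationary fibres. -/
theorem exists_stationaryAt_fibers (hD : D.IsRegular) (hL : D < cof L)
    (hIio : ∀ a : L, #(Iio a) ≤ D) :
    ∃ (k : L → L) (Γ : Set L), D < #Γ ∧ ∀ γ ∈ Γ, StationaryAt D (k ⁻¹' {γ}) := by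
  classical
  obtain ⟨g, hg⟩ := exists_injOn_Iio hD.ne_zero hIio
  have hcell : ∀ α : L, ∃ i, StationaryAt D {β | α < β ∧ g β α = i} := by
    intro α
    refine StationaryAt.exists_of_iUnion ((mk_ord_toType D).trans_lt hL) ?_
    exact ((stationaryAt_univ hD hL hIio).inter_closed id α).mono fun β hβ =>
      mem_iUnion.2 ⟨g β α, hβ.2.2.1, rfl⟩
  choose i hi using hcell
  have hreg := isRegular_succ hD.aleph0_le
  obtain ⟨i₀, hi₀⟩ := infinite_pigeonhole_card i (succ D)
    (succ_le_of_lt (hL.trans_le (cof_le_cardinalMk L))) hreg.aleph0_le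
    (by rw [mk_ord_toType, hreg.cof_ord]; exact lt_succ D)
  refine ⟨fun β => if h : ∃ α < β, g β α = i₀ then h.choose else β, i ⁻¹' {i₀},
    lt_of_lt_of_le (lt_succ D) hi₀, fun γ hγ => (hi γ).mono fun β hβ => ?_⟩
  have hex : ∃ α < β, g β α = i₀ := ⟨γ, hβ.1, hβ.2.trans hγ⟩
  simp only [mem_preimage, mem_singleton_iff, dif_pos hex]
  exact hg β hex.choose_spec.1 hβ.1 (hex.choose_spec.2.trans (hβ.2.trans hγ).symm)

end Stationary

section Walks

variable {L : Type v} [LinearOrder L] {D : Cardinal.{v}}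

/-! ### Walks along ladders -/

/-- A ladder system: `e a` is cofinal among the points below `a` (for a successor `a`, it contains
the predecessor), and has fewer than `D` elements below any `b < a`. The sets `e a` need not be
closed. -/
structure IsLadder (D : Cardinal.{v}) (e : L → Set L) : Prop where
  cofinal : ∀ a, ∀ b < a, ∃ c ∈ e a, b ≤ c ∧ c < a
  small : ∀ a, ∀ b < a, #(e a ∩ Iio b : Set L) < D

/-- For an injection `g` of the points below `a` into the cardinal `D`, the points at which `g` is
smaller than at every later point form a cofinal set on which `g` is increasing. -/
theorem exists_isLadder (hD : D ≠ 0) (hIio : ∀ a : L, #(Iio a) ≤ D) :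
    ∃ e : L → Set L, IsLadder D e := by
  obtain ⟨g, hg⟩ := exists_injOn_Iio hD hIio
  have hcof : ∀ a, ∀ b < a, ∃ c ∈ {x | x < a ∧ ∀ y, x < y → y < a → g a x < g a y},
      b ≤ c ∧ c < a := by
    intro a b hb
    obtain ⟨_, ⟨c, hc, rfl⟩, hmin⟩ := WellFounded.has_min
      (wellFounded_lt (α := D.ord.ToType)) (g a '' Ico b a) ⟨_, b, ⟨le_rfl, hb⟩, rfl⟩
    refine ⟨c, ⟨hc.2, fun y hcy hya => ?_⟩, hc⟩
    exact (not_lt.1 (hmin _ ⟨y, ⟨hc.1.trans hcy.le, hya⟩, rfl⟩)).lt_of_ne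
      fun h => hcy.ne (hg a hc.2 hya h)
  refine ⟨fun a => {x | x < a ∧ ∀ y, x < y → y < a → g a x < g a y}, hcof, fun a b hb => ?_⟩
  obtain ⟨c, -, hbc, hca⟩ := hcof a b hb
  refine lt_of_le_of_lt ?_ (mk_Iio_toType_ord (g a c))
  refine mk_le_of_injective (f := fun x => ⟨g a x, x.2.1.2 c (x.2.2.trans_le hbc) hca⟩) ?_
  intro x y h
  exact Subtype.ext (hg a x.2.1.1 y.2.1.1 (congrArg Subtype.val h))

variable [WellFoundedLT L]

open Classical in
/-- The step from `a` towards `b < a`: the least point of the ladder `e a` that is at least `b`.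
If there is none, the step leads directly to `b`. -/
noncomputable def ladderStep (e : L → Set L) (b a : L) : L :=
  if h : (e a ∩ Ico b a).Nonempty then wellFounded_lt.min _ h else b

theorem ladderStep_mem_Ico (e : L → Set L) {b a : L} (h : b < a) :
    ladderStep e b a ∈ Ico b a := by
  unfold ladderStep
  split_ifs with h'
  · exact (WellFounded.min_mem _ _ h').2
  · exact ⟨le_rfl, h⟩

/-- The walk from `a` down to `b`: the list of the points visited, starting with `a` and
excluding `b` itself. -/
noncomputable def walk (e : L → Set L) (b a : L) : List L :=
  if _h : b < a then a :: walk e b (ladderStep e b a) else []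
termination_by wellFounded_lt.wrap a
decreasing_by exact (ladderStep_mem_Ico e _h).2

theorem walk_self (e : L → Set L) (a : L) : walk e a a = [] := by
  rw [walk, dif_neg (lt_irrefl a)]

theorem walk_of_lt (e : L → Set L) {b a : L} (h : b < a) :
    walk e b a = a :: walk e b (ladderStep e b a) := by
  rw [walk, dif_pos h]

theorem mem_walk_of_lt (e : L → Set L) {b a : L} (h : b < a) : a ∈ walk e b a := by
  simp [walk_of_lt e h]

/-- A walk from `a` to a point `ξ` just below a point `δ` of cofinality at least `D` passes through
`δ`: no ladder of a point above `δ` accumulates to `δ`. -/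
theorem IsLadder.exists_walk_eq_append {e : L → Set L} (he : IsLadder D e) (hD : D ≠ 0) {δ : L}
    (hδ : D ≤ cof (Iio δ)) (a : L) (ha : δ ≤ a) :
    ∃ η < δ, ∀ ξ, η ≤ ξ → ξ < δ → walk e ξ a = walk e δ a ++ walk e ξ δ := by
  induction a using WellFoundedLT.induction with
  | ind a ih =>
  rcases ha.lt_or_eq with ha | rfl
  · obtain ⟨hδs, hsa⟩ := ladderStep_mem_Ico e ha
    obtain ⟨η₁, hη₁, h₁⟩ := ih _ hsa hδs
    obtain ⟨η₂, hη₂, h₂⟩ := exists_lt_forall_lt_of_mk_lt_cof_Iio ((he.small a δ ha).trans_le hδ)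
      (fun x => (x : L)) fun x => x.2.2
    refine ⟨max η₁ η₂, max_lt hη₁ hη₂, fun ξ hξ hξδ => ?_⟩
    obtain ⟨hξ₁, hξ₂⟩ := max_le_iff.1 hξ
    have hset : e a ∩ Ico ξ a = e a ∩ Ico δ a := by
      ext c
      refine ⟨fun hc => ⟨hc.1, ?_, hc.2.2⟩, fun hc => ⟨hc.1, hξδ.le.trans hc.2.1, hc.2.2⟩⟩
      by_contra! hcδ
      exact ((h₂ ⟨c, hc.1, hcδ⟩).trans_le hξ₂).not_ge hc.2.1
    have hne : (e a ∩ Ico δ a).Nonempty :=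
      let ⟨c, hc, hc'⟩ := he.cofinal a δ ha
      ⟨c, hc, hc'⟩
    have hstep : ladderStep e ξ a = ladderStep e δ a := by
      have hne' : (e a ∩ Ico ξ a).Nonempty := hset ▸ hne
      rw [ladderStep, ladderStep, dif_pos hne, dif_pos hne']
      congr 1
    rw [walk_of_lt e (hξδ.trans ha), walk_of_lt e ha, hstep, h₁ ξ hξ₁ hξδ, List.cons_append]
  · have : Nonempty (Iio δ) := by
      rw [← cof_ne_zero_iff]
      exact fun h => hD (le_zero_iff.1 (h ▸ hδ))
    obtain ⟨η, hη⟩ := this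
    exact ⟨η, hη, fun ξ _ _ => by rw [walk_self, List.nil_append]⟩

/-- The bound below `δ` can be chosen simultaneously for fewer than `D` walks. -/
theorem IsLadder.exists_forall_walk_eq_append {e : L → Set L} (he : IsLadder D e) (hD : D ≠ 0)
    {δ : L} (hδ : D ≤ cof (Iio δ)) {I : Type v} (hI : #I < D) (a : I → L) (ha : ∀ i, δ ≤ a i) :
    ∃ η < δ, ∀ i ξ, η ≤ ξ → ξ < δ → walk e ξ (a i) = walk e δ (a i) ++ walk e ξ δ := by
  choose f hf h using fun i => he.exists_walk_eq_append hD hδ (a i) (ha i)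
  obtain ⟨η, hη, hfη⟩ := exists_lt_forall_lt_of_mk_lt_cof_Iio (hI.trans_le hδ) f hf
  exact ⟨η, hη, fun i ξ hξ => h i ξ ((hfη i).le.trans hξ)⟩

/-! ### Rectangles of walks with a common middle part -/

/-- A family of sequences `x α`, `α : L`, escapes if every point lies below all terms of `x α`
for all large `α`. -/
def Escapes {I : Type v} (x : L → I → L) : Prop :=
  ∀ δ, ∃ β, ∀ α, β ≤ α → ∀ i, δ < x α i

variable {N : Type v} [LinearOrder N]

theorem exists_label_bound {X : Type*} (lab : X → N) {I : Type v} (hI : #I < cof N)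
    (l : I → List X) :
    ∃ ε, ∀ i, ∀ c ∈ l i, lab c ≤ ε := by
  have : Nonempty N := by
    rw [← cof_ne_zero_iff]
    exact (pos_of_gt hI).ne'
  have hfin : ∀ l : List X, ∃ n, ∀ c ∈ l, lab c ≤ n := by
    intro l
    induction l with
    | nil => exact ⟨Classical.arbitrary N, by simp⟩
    | cons a l ih =>
      obtain ⟨n, hn⟩ := ih
      refine ⟨max (lab a) n, fun c hc => ?_⟩
      rcases List.mem_cons.1 hc with rfl | hc
      · exact le_max_left _ _
      · exact (hn c hc).trans (le_max_right _ _)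
  choose n hn using fun i => hfin (l i)
  obtain ⟨ε, hε⟩ := exists_forall_lt_of_mk_lt_cof hI n
  exact ⟨ε, fun i c hc => (hn i c hc).trans (hε i).le⟩

/-- For escaping families `x` and `y` of short sequences and a stationary `R`, some `x α₀` lies
below some `y α₁`, and all walks from `y α₁` to `x α₀` share a middle part `χ` that meets `R` and
contains a label exceeding all labels outside of `χ`. The walks pass through points
`δ₁ > δ₂ > δ₃ > δ₄`, and `χ` is the part from `δ₁` to `δ₄`: the labels before `δ₁` and after `δ₄`
are bounded in advance, `δ₂` has a larger label, and `δ₃` is in `R`. -/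
theorem exists_rectangle {e : L → Set L} (he : IsLadder D e) (hD : D.IsRegular) (hL : D < cof L)
    (hIio : ∀ a : L, #(Iio a) ≤ D) (hN : #N < D) {lab : L → N}
    (hlab : ∀ ε, StationaryAt D {δ | ε < lab δ}) {R : Set L} (hR : StationaryAt D R)
    {I₀ I₁ : Type v} (hI₀ : #I₀ < cof N) (hI₁ : #I₁ < cof N)
    {x : L → I₀ → L} {y : L → I₁ → L} (hx : Escapes x) (hy : Escapes y) :
    ∃ α₀ α₁, α₀ < α₁ ∧ ∃ (χ : List L) (ε : N), (∃ r ∈ χ, r ∈ R) ∧ (∃ c ∈ χ, ε < lab c) ∧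
      ∀ i j, x α₀ i < y α₁ j ∧ ∃ ρ σ, walk e (x α₀ i) (y α₁ j) = ρ ++ (χ ++ σ) ∧
        (∀ c ∈ ρ, lab c ≤ ε) ∧ ∀ c ∈ σ, lab c ≤ ε := by
  have hND : cof N < D := (cof_le_cardinalMk N).trans_lt hN
  have hstat := stationaryAt_univ hD hL hIio
  have : Nonempty L := cof_ne_zero_iff.1 (pos_of_gt hL).ne'
  have : NoMaxOrder L := noMaxOrder_of_lt_cof hD hL
  -- Walks from members of `y` to a point `δ₁`, with labels at most `ε₁`, are stable above `η₁`.
  have hα₁ : ∀ δ, ∃ α, δ < α ∧ ∀ j, δ < y α j := by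
    intro δ
    obtain ⟨β, hβ⟩ := hy δ
    obtain ⟨α, hα⟩ := exists_gt (max δ β)
    exact ⟨α, (le_max_left _ _).trans_lt hα, hβ α ((le_max_right _ _).trans hα.le)⟩
  choose a₁ ha₁ hya₁ using hα₁
  choose b₁ hb₁ using fun δ => exists_label_bound lab hI₁ fun j => walk e δ (y (a₁ δ) j)
  obtain ⟨ε₁, hε₁⟩ : ∃ ε, StationaryAt D {δ | D ≤ cof (Iio δ) ∧ b₁ δ = ε} := by
    refine StationaryAt.exists_of_iUnion (hN.trans hL) ((hstat.inter_closed id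
      (Classical.arbitrary L)).mono fun δ hδ => mem_iUnion.2 ⟨b₁ δ, hδ.2.1, rfl⟩)
  have hst₁ : ∀ δ, D ≤ cof (Iio δ) → ∃ η < δ, ∀ j ξ, η ≤ ξ → ξ < δ →
      walk e ξ (y (a₁ δ) j) = walk e δ (y (a₁ δ) j) ++ walk e ξ δ := fun δ hδ =>
    he.exists_forall_walk_eq_append hD.ne_zero hδ (hI₁.trans hND) _ fun j => (hya₁ δ j).le
  choose! f₁ hf₁ hst₁ using hst₁
  obtain ⟨η₁, hη₁⟩ := hε₁.exists_bound_of_regressive f₁ fun δ hδ => hf₁ δ hδ.1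
  -- Walks from a point `δ₄` to all members of some `x α` have labels at most `ε₀`.
  have hg₀ : ∀ η, ∃ α z, α < z ∧ ∀ i, η ≤ x α i ∧ x α i < z := by
    intro η
    obtain ⟨α, hα⟩ := hx η
    obtain ⟨z, hz⟩ := exists_forall_lt_of_mk_lt_cof ((hI₀.trans hND).trans hL) (x α)
    obtain ⟨w, hw⟩ := exists_gt (max α z)
    exact ⟨α, w, (le_max_left _ _).trans_lt hw, fun i =>
      ⟨(hα α le_rfl i).le, (hz i).trans ((le_max_right _ _).trans_lt hw)⟩⟩
  choose a₀ g₀ ha₀ hxa₀ using hg₀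
  obtain ⟨ε₀, hε₀⟩ : ∃ ε, StationaryAt D {δ | D ≤ cof (Iio δ) ∧ ∀ η < δ, ∃ α < δ,
      ∀ i, η ≤ x α i ∧ x α i < δ ∧ ∀ c ∈ walk e (x α i) δ, lab c ≤ ε} := by
    refine StationaryAt.exists_of_iUnion (hN.trans hL) ((hstat.inter_closed g₀
      (Classical.arbitrary L)).mono fun δ hδ => mem_iUnion.2 ?_)
    obtain ⟨-, hδ, -, hclosed⟩ := hδ
    choose b hb using fun ξ => exists_label_bound lab hI₀ fun i => walk e (x (a₀ ξ) i) δ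
    obtain ⟨ε, hε⟩ := exists_bound_cofinally (hN.trans_le hδ) b
    refine ⟨ε, hδ, fun η hη => ?_⟩
    obtain ⟨ξ, hηξ, hξδ, hbξ⟩ := hε η hη
    exact ⟨a₀ ξ, (ha₀ ξ).trans (hclosed ξ hξδ), fun i => ⟨hηξ.trans (hxa₀ ξ i).1,
      (hxa₀ ξ i).2.trans (hclosed ξ hξδ), fun c hc => (hb ξ i c hc).trans hbξ⟩⟩
  -- Points `δ₂` with a label above both bounds, below suitable `δ₁`, stable above `η₂`.
  choose d₁ hd₁ hd₁lt hd₁η using hη₁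
  have hst₂ : ∀ δ, D ≤ cof (Iio δ) → ∃ η < δ, ∀ ξ, η ≤ ξ → ξ < δ →
      walk e ξ (d₁ δ) = walk e δ (d₁ δ) ++ walk e ξ δ := fun δ hδ =>
    he.exists_walk_eq_append hD.ne_zero hδ _ (hd₁lt δ).le
  choose! f₂ hf₂ hst₂ using hst₂
  obtain ⟨η₂, hη₂⟩ := ((hlab (max ε₀ ε₁)).inter_closed id
    (Classical.arbitrary L)).exists_bound_of_regressive f₂ fun δ hδ => hf₂ δ hδ.2.1
  -- The point `δ₃` in `R` is chosen as a limit of possible `δ₄`.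
  choose t ht htlt using fun a => hε₀.exists_gt a
  obtain ⟨δ₃, hδ₃R, hδ₃, hδ₃η, hδ₃t⟩ := hR (max η₁ η₂) t
  obtain ⟨δ₂, ⟨hδ₂lab, hδ₂, -⟩, hδ₃₂, hδ₂η⟩ := hη₂ δ₃
  obtain ⟨η₃, hη₃, hst₃⟩ := he.exists_walk_eq_append hD.ne_zero hδ₃ δ₂ hδ₃₂.le
  have hη := htlt (max (max η₁ η₂) η₃)
  have hδ₄₃ := hδ₃t _ (max_lt hδ₃η hη₃)
  obtain ⟨hδ₄, hδ₄x⟩ := ht (max (max η₁ η₂) η₃)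
  generalize t (max (max η₁ η₂) η₃) = δ₄ at *
  obtain ⟨η₄, hη₄, hst₄⟩ := he.exists_walk_eq_append hD.ne_zero hδ₄ δ₃ hδ₄₃.le
  obtain ⟨α₀, hα₀, hxα₀⟩ := hδ₄x (max (max (max η₁ η₂) η₃) η₄) (max_lt hη hη₄)
  obtain ⟨hδ₁, hδ₁b⟩ := hd₁ δ₂
  have hδ₂₁ := hd₁lt δ₂
  have hδ₁η := hd₁η δ₂
  have hst₂ := hst₂ δ₂ hδ₂
  generalize d₁ δ₂ = δ₁ at *
  have hδ₄₁ : δ₄ < δ₁ := hδ₄₃.trans (hδ₃₂.trans hδ₂₁)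
  refine ⟨α₀, a₁ δ₁, hα₀.trans (hδ₄₁.trans (ha₁ δ₁)),
    walk e δ₂ δ₁ ++ (walk e δ₃ δ₂ ++ walk e δ₄ δ₃), max ε₀ ε₁,
    ⟨δ₃, by simp [mem_walk_of_lt e hδ₄₃], hδ₃R⟩,
    ⟨δ₂, by simp [mem_walk_of_lt e hδ₃₂], hδ₂lab⟩, fun i j => ?_⟩
  obtain ⟨hxη, hxδ₄, hxlab⟩ := hxα₀ i
  simp only [max_le_iff] at hxη
  obtain ⟨⟨⟨h₁, h₂⟩, h₃⟩, h₄⟩ := hxη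
  have hxδ₃ := hxδ₄.trans hδ₄₃
  have hxδ₂ := hxδ₃.trans hδ₃₂
  have hxδ₁ := hxδ₂.trans hδ₂₁
  refine ⟨hxδ₁.trans (hya₁ δ₁ j), walk e δ₁ (y (a₁ δ₁) j), walk e (x α₀ i) δ₄, ?_,
    fun c hc => ((hb₁ δ₁ j c hc).trans_eq hδ₁b).trans (le_max_right _ _),
    fun c hc => (hxlab c hc).trans (le_max_left _ _)⟩
  rw [hst₁ δ₁ hδ₁ j _ (hδ₁η.trans h₁) hxδ₁, hst₂ _ (hδ₂η.trans h₂) hxδ₂, hst₃ _ h₃ hxδ₃,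
    hst₄ _ h₄ hxδ₄]
  simp only [List.append_assoc]

end Walks

section Colouring

variable {L : Type v} [LinearOrder L] {D : Cardinal.{v}} {N : Type v} [LinearOrder N]

/-! ### Escaping families -/

/-- A family of pairwise disjoint one-to-one sequences escapes. -/
theorem escapes_of_injective (hD : D.IsRegular) (hL : D < cof L) (hIio : ∀ a : L, #(Iio a) ≤ D)
    {I : Type v} {x : L → I → L} (hx : Function.Injective (Function.uncurry x)) : Escapes x := by
  have := noMaxOrder_of_lt_cof hD hL
  intro δ
  obtain ⟨δ', hδ'⟩ := exists_gt δ
  choose i hi using fun α : {α | ∃ i, x α i ≤ δ} => α.2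
  have hcard : #{α | ∃ i, x α i ≤ δ} ≤ D := by
    refine le_trans ?_ (hIio δ')
    refine mk_le_of_injective (f := fun α => ⟨x α (i α), (hi α).trans_lt hδ'⟩) fun α β h => ?_
    have : (α.1, i α) = (β.1, i β) := hx (congrArg Subtype.val h)
    exact Subtype.ext (congrArg Prod.fst this)
  obtain ⟨b, hb⟩ := exists_forall_lt_of_mk_lt_cof (hcard.trans_lt hL) Subtype.val
  refine ⟨b, fun α hα i => ?_⟩
  by_contra! h
  exact (hb ⟨α, i, h⟩).not_ge hα

/-- Countably many escaping families of short sequences can be concatenated. -/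
theorem Escapes.sigma (hL : ℵ₀ < cof L) {M : Type} [Countable M] {I : M → Type v}
    {x : ∀ m, L → I m → L} (hx : ∀ m, Escapes (x m)) :
    Escapes fun α (i : Σ m, I m) => x i.1 α i.2 := by
  intro δ
  choose β hβ using fun m => hx m δ
  obtain ⟨b, hb⟩ := exists_forall_lt_of_mk_lt_cof (I := ULift.{v} M)
    ((by simp : #(ULift.{v} M) ≤ ℵ₀).trans_lt hL) fun m => β m.down
  exact ⟨b, fun α hα i => hβ i.1 α ((hb ⟨i.1⟩).le.trans hα) i.2⟩

/-! ### Locating a point of the common middle part -/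

open Classical in
/-- The position of the first entry of `l` that has the greatest label. -/
noncomputable def firstMaxIdx {X : Type*} (lab : X → N) (l : List X) : ℕ :=
  l.findIdx fun a => ∀ b ∈ l, lab b ≤ lab a

theorem List.findIdx_congr_of_mem {X : Type*} {p q : X → Bool} {l : List X}
    (h : ∀ a ∈ l, p a = q a) : l.findIdx p = l.findIdx q := by
  induction l with
  | nil => rfl
  | cons a l ih =>
    rw [List.findIdx_cons, List.findIdx_cons, h a List.mem_cons_self,
      ih fun b hb => h b (List.mem_cons_of_mem a hb)]

/-- If some label in the middle part `χ` of a list exceeds all labels outside of `χ`, then the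
first greatest label sits in `χ`, at a position that depends on `χ` only. -/
theorem firstMaxIdx_append {X : Type*} {lab : X → N} {ρ χ σ : List X} {ε : N}
    (hχ : ∃ c ∈ χ, ε < lab c) (hρ : ∀ c ∈ ρ, lab c ≤ ε) (hσ : ∀ c ∈ σ, lab c ≤ ε) :
    firstMaxIdx lab (ρ ++ (χ ++ σ)) = ρ.length + firstMaxIdx lab χ := by
  classical
  obtain ⟨c, hc, hcε⟩ := hχ
  obtain ⟨t, ht, htmax⟩ := χ.toFinset.exists_max_image lab ⟨c, List.mem_toFinset.2 hc⟩
  simp only [List.mem_toFinset] at ht htmax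
  have htε : ε < lab t := hcε.trans_le (htmax c hc)
  have hρ' : ρ.findIdx (fun a => ∀ b ∈ ρ ++ (χ ++ σ), lab b ≤ lab a) = ρ.length := by
    rw [List.findIdx_eq_length]
    intro a ha
    simp only [decide_eq_false_iff_not]
    exact fun h => ((h t (by simp [ht])).trans (hρ a ha)).not_gt htε
  have hiff : ∀ a ∈ χ, (∀ b ∈ ρ ++ (χ ++ σ), lab b ≤ lab a) ↔ ∀ b ∈ χ, lab b ≤ lab a := by
    intro a ha
    refine ⟨fun h b hb => h b (by simp [hb]), fun h b hb => ?_⟩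
    have hta := h t ht
    simp only [List.mem_append] at hb
    rcases hb with hb | hb | hb
    · exact (hρ b hb).trans (htε.le.trans hta)
    · exact h b hb
    · exact (hσ b hb).trans (htε.le.trans hta)
  have hχ' : χ.findIdx (fun a => ∀ b ∈ ρ ++ (χ ++ σ), lab b ≤ lab a) =
      χ.findIdx fun a => ∀ b ∈ χ, lab b ≤ lab a :=
    List.findIdx_congr_of_mem fun a ha => by simp only [hiff a ha]
  have hlt : χ.findIdx (fun a => ∀ b ∈ χ, lab b ≤ lab a) < χ.length :=
    List.findIdx_lt_length_of_exists ⟨t, ht, by simpa using htmax⟩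
  rw [firstMaxIdx, firstMaxIdx, List.findIdx_append, hρ', if_neg (lt_irrefl _),
    List.findIdx_append, hχ', if_pos hlt, add_comm]

/-- The entry of `l` that comes `m.1 - m.2` places after the first entry with the greatest label
(and a default value `d` if there is no such place). -/
noncomputable def offsetEntry {X : Type*} (lab : X → N) (m : ℕ × ℕ) (d : X) (l : List X) : X :=
  l.getD (firstMaxIdx lab l + m.1 - m.2) d

/-- An entry `r` of the middle part `χ` sits at the same offset in all lists `ρ ++ (χ ++ σ)` in
which some label in `χ` exceeds all labels outside of `χ`. -/
theorem exists_offsetEntry_eq {X : Type*} {lab : X → N} {χ : List X} {r : X} (hr : r ∈ χ) {ε : N}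
    (hχ : ∃ c ∈ χ, ε < lab c) :
    ∃ m, ∀ d ρ σ, (∀ c ∈ ρ, lab c ≤ ε) → (∀ c ∈ σ, lab c ≤ ε) →
      offsetEntry lab m d (ρ ++ (χ ++ σ)) = r := by
  obtain ⟨n, hn, rfl⟩ := List.getElem_of_mem hr
  refine ⟨(n, firstMaxIdx lab χ), fun d ρ σ hρ hσ => ?_⟩
  have : ρ.length + firstMaxIdx lab χ + n - firstMaxIdx lab χ = ρ.length + n := by omega
  rw [offsetEntry, firstMaxIdx_append hχ hρ hσ, this]
  simp [List.getD_eq_getElem?_getD, List.getElem?_append_right, List.getElem?_append_left, hn]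

variable [WellFoundedLT L]

/-- For all escaping families `x` and `y` of sequences of length less than `T`, there is a
rectangle `x α₀ × y α₁`, `α₀ < α₁`, with `x α₀` below `y α₁`, on which all values of `p` are
in `R`. -/
def HitsRectangles (T : Cardinal.{v}) (p : L → L → L) (R : Set L) : Prop :=
  ∀ ⦃I₀ I₁ : Type v⦄, #I₀ < T → #I₁ < T → ∀ ⦃x : L → I₀ → L⦄ ⦃y : L → I₁ → L⦄,
    Escapes x → Escapes y →
    ∃ α₀ α₁, α₀ < α₁ ∧ ∀ i j, x α₀ i < y α₁ j ∧ p (x α₀ i) (y α₁ j) ∈ R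

/-- For each stationary `R`, a single offset locates points of `R` on all rectangles: otherwise
counterexamples for the countably many offsets could be concatenated to a pair of families on
which every offset fails. -/
theorem exists_hitsRectangles {e : L → Set L} (he : IsLadder D e) (hD : D.IsRegular)
    (hL : D < cof L) (hIio : ∀ a : L, #(Iio a) ≤ D) (hN : #N < D) (hNreg : (cof N).IsRegular)
    (hN₀ : ℵ₀ < cof N) {lab : L → N} (hlab : ∀ ε, StationaryAt D {δ | ε < lab δ}) {R : Set L}
    (hR : StationaryAt D R) (d : L) :
    ∃ m, HitsRectangles (cof N) (fun ξ ζ => offsetEntry lab m d (walk e ξ ζ)) R := by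
  by_contra! H
  simp only [HitsRectangles] at H
  push Not at H
  choose I₀ I₁ hI₀ hI₁ x y hx hy H using H
  have hsigma : ∀ I : ℕ × ℕ → Type v, (∀ m, #(I m) < cof N) → #(Σ m, I m) < cof N := by
    intro I hI
    rw [mk_sigma]
    exact sum_lt_lift_of_isRegular hNreg (by simpa using hN₀) hI
  have hL₀ : ℵ₀ < cof L := hD.aleph0_le.trans_lt hL
  obtain ⟨α₀, α₁, hα, χ, ε, ⟨r, hrχ, hrR⟩, hχ, h⟩ := exists_rectangle he hD hL hIio hN hlab hR
    (hsigma I₀ hI₀) (hsigma I₁ hI₁) (Escapes.sigma hL₀ hx) (Escapes.sigma hL₀ hy)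
  obtain ⟨m, hm⟩ := exists_offsetEntry_eq hrχ hχ
  obtain ⟨i, j, hij⟩ := H m α₀ α₁ hα
  obtain ⟨hlt, ρ, σ, hw, hρ, hσ⟩ := h ⟨m, i⟩ ⟨m, j⟩
  refine hij hlt ?_
  simp only at hw
  rw [hw, hm d ρ σ hρ hσ]
  exact hrR

/-! ### The colouring -/

/-- A colouring that takes every value on every rectangle: fix an offset that locates points of
`k ⁻¹' {γ}` for as many `γ` as there are points, and colour by the value of `k` at the located
point, after renaming these `γ`. -/
theorem exists_colouring (hD : D.IsRegular) (hL : D < cof L) (hLD : #L ≤ succ D)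
    (hIio : ∀ a : L, #(Iio a) ≤ D) {T : Cardinal.{v}} (hT : T.IsRegular) (hT₀ : ℵ₀ < T)
    (hTD : T < D) :
    ∃ c : L → L → L, ∀ γ, HitsRectangles T c {γ} := by
  obtain ⟨k, Γ, hΓ, hk⟩ := exists_stationaryAt_fibers hD hL hIio
  have : Nonempty L := cof_ne_zero_iff.1 (pos_of_gt hL).ne'
  have hcofN : cof T.ord.ToType = T := by rw [Ordinal.cof_toType, hT.cof_ord]
  have : NoMaxOrder T.ord.ToType := Cardinal.noMaxOrder hT.aleph0_le
  have : Nonempty T.ord.ToType := by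
    rw [← mk_ne_zero_iff, mk_ord_toType]
    exact hT.ne_zero
  -- Labels: each element of `T` labels a stationary fibre of `k`.
  obtain ⟨f⟩ : Nonempty (T.ord.ToType ↪ Γ) := by
    rw [← Cardinal.le_def, mk_ord_toType]
    exact (hTD.trans hΓ).le
  have hf : Function.Injective fun ε => (f ε : L) := Subtype.val_injective.comp f.injective
  let lab : L → T.ord.ToType := fun δ => Function.invFun (fun ε => (f ε : L)) (k δ)
  have hlab : ∀ ε, StationaryAt D {δ | ε < lab δ} := by
    intro ε
    obtain ⟨ε', hε'⟩ := exists_gt ε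
    refine (hk (f ε') (f ε').2).mono fun δ hδ => ?_
    have : lab δ = ε' := by
      change Function.invFun _ (k δ) = ε'
      rw [show k δ = f ε' from hδ]
      exact Function.leftInverse_invFun hf ε'
    rwa [mem_ofPred_eq, this]
  obtain ⟨e, he⟩ := exists_isLadder hD.ne_zero hIio
  have hm : ∀ γ : Γ, ∃ m, HitsRectangles T (fun ξ ζ => offsetEntry lab m (Classical.arbitrary L)
      (walk e ξ ζ)) (k ⁻¹' {(γ : L)}) := by
    intro γ
    have := exists_hitsRectangles he hD hL hIio ((mk_ord_toType T).trans_lt hTD)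
      (by rwa [hcofN]) (by rwa [hcofN]) hlab (hk γ γ.2) (Classical.arbitrary L)
    rwa [hcofN] at this
  choose m hm using hm
  -- The same offset works for `#L` many fibres of `k`.
  have hreg := isRegular_succ hD.aleph0_le
  obtain ⟨⟨m₀⟩, hm₀⟩ := infinite_pigeonhole_card (fun γ => ULift.up.{v} (m γ)) (succ D)
    (succ_le_of_lt hΓ) hreg.aleph0_le (by
      rw [hreg.cof_ord]
      exact (by simp : #(ULift.{v} (ℕ × ℕ)) ≤ ℵ₀).trans_lt
        (hD.aleph0_le.trans_lt (lt_succ D)))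
  obtain ⟨j⟩ := (Cardinal.le_def _ _).1 (hLD.trans hm₀)
  have hj : Function.Injective fun γ => (j γ : L) :=
    Subtype.val_injective.comp (Subtype.val_injective.comp j.injective)
  refine ⟨fun ξ ζ => Function.invFun (fun γ => (j γ : L))
    (k (offsetEntry lab m₀ (Classical.arbitrary L) (walk e ξ ζ))),
    fun γ I₀ I₁ hI₀ hI₁ x y hx hy => ?_⟩
  have hjm : m (j γ) = m₀ := congrArg ULift.down (j γ).2
  obtain ⟨α₀, α₁, hα, h⟩ := hm (j γ) hI₀ hI₁ hx hy
  rw [hjm] at h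
  refine ⟨α₀, α₁, hα, fun i i' => ⟨(h i i').1, ?_⟩⟩
  have h2 := (h i i').2
  simp only [mem_preimage, mem_singleton_iff] at h2
  simp only [mem_singleton_iff, h2]
  exact Function.leftInverse_invFun hj γ

end Colouring

/-! ### Successors of regular cardinals -/

theorem mk_Iio_ordBelow_succ_le (del : Cardinal.{u}) (a : OrdBelow (succ del)) :
    #(Iio a) ≤ lift.{u + 1} del := by
  have h : #(Iio a) ≤ #(Iio a.1) :=
    mk_le_of_injective (f := fun b : Iio a => (⟨b.1.1, b.2⟩ : Iio a.1)) fun b c hbc =>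
      Subtype.ext (Subtype.ext (congrArg (fun z : Iio a.1 => z.1) hbc))
  refine h.trans ?_
  rw [mk_Iio_ordinal, lift_le]
  exact lt_succ_iff.1 (lt_ord.1 a.2)

theorem min'_mkPair {X : Type*} [LinearOrder X] [DecidableEq X] {x y : X} (h : x ≠ y)
    (hxy : x < y) (hne : (mkPair x y h).1.Nonempty) : (mkPair x y h).1.min' hne = x := by
  refine le_antisymm (Finset.min'_le _ _ (by simp [mkPair])) (Finset.le_min' _ _ _ ?_)
  simp [mkPair, hxy.le]

theorem max'_mkPair {X : Type*} [LinearOrder X] [DecidableEq X] {x y : X} (h : x ≠ y)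
    (hxy : x < y) (hne : (mkPair x y h).1.Nonempty) : (mkPair x y h).1.max' hne = y := by
  refine le_antisymm (Finset.max'_le _ _ _ ?_) (Finset.le_max' _ _ (by simp [mkPair]))
  simp [mkPair, hxy.le]

theorem theorem2p2 (lam del theta : Cardinal.{u})
    (hlam : lam = Order.succ del)
    (hdel : del.IsRegular) (htheta : theta.IsRegular)
    (hlt : Order.succ theta < del) :
    Pr₁ lam lam lam theta := by
  subst hlam
  have hreg := isRegular_succ hdel.aleph0_le
  have hD : (lift.{u + 1} del).IsRegular := hdel.lift
  have hcof : cof (OrdBelow (succ del)) = lift.{u + 1} (succ del) := by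
    rw [Ordinal.cof_Iio, lift_ord, hreg.lift.cof_ord]
  have hL : lift.{u + 1} del < cof (OrdBelow (succ del)) := by
    rw [hcof, lift_lt]
    exact lt_succ del
  have hLD : #(OrdBelow (succ del)) ≤ succ (lift.{u + 1} del) := by
    rw [mk_Iio_ordinal, card_ord, lift_succ]
  have hIio := mk_Iio_ordBelow_succ_le del
  -- Sequences of length less than `theta` are treated as sequences of length less than the
  -- successor of `theta`, which is uncountable.
  obtain ⟨c, hc⟩ := exists_colouring hD hL hLD hIio (T := lift.{u + 1} (succ theta))
    (isRegular_succ htheta.aleph0_le).lift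
    (by rw [aleph0_lt_lift]; exact htheta.aleph0_le.trans_lt (lt_succ theta))
    (lift_lt.2 hlt)
  have hI : ∀ i < theta.ord, #(Iio i) < lift.{u + 1} (succ theta) := by
    intro i hi
    rw [mk_Iio_ordinal, lift_lt]
    exact (lt_ord.1 hi).trans (lt_succ theta)
  have hne : ∀ s : UnorderedPairs (OrdBelow (succ del)), s.1.Nonempty := fun s =>
    Finset.card_pos.1 (by rw [s.2]; exact two_pos)
  refine ⟨fun s => c (s.1.min' (hne s)) (s.1.max' (hne s)), ?_⟩
  intro i₀ i₁ hi₀ hi₁ ζ₀ ζ₁ hζ₀ hζ₁ hdisj γ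
  obtain ⟨α₀, α₁, hα, h⟩ := hc γ (hI i₀ hi₀) (hI i₁ hi₁)
    (escapes_of_injective hD hL hIio hζ₀) (escapes_of_injective hD hL hIio hζ₁)
  refine ⟨α₀, α₁, hα, fun j₀ j₁ => ?_⟩
  obtain ⟨hlt, hcol⟩ := h j₀ j₁
  simpa only [min'_mkPair _ hlt, max'_mkPair _ hlt, mem_singleton_iff] using hcol
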